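/- Let $p_1,p_2,\dots>0$ with $\sum_{k\ge1}p_k=1$ (for instance, a nonincreasing probability distribution on $\{1,2,\dots\}$ with unbounded support). Consider bits indexed by $k=1,2,\dots$, all in state $0$ (idle) at time $0$. For each $k$ let bit $k$ be selected at the successive times of a renewal process whose holding times are independent and exponentially distributed with rate $p_k$, independently for different $k$. In the Binary Flipping (BF) model every selection of a bit changes its state $x\in\{0,1\}$ to $1-x$; in the Damaged Bits (DB) model every selection of a bit changes its state $x\in\{0,1,2\}$ to $\min\{2,1+x\}$. In both models a bit in state $1$ is called active, and $n_t$ denotes the number of active bits at time $t\ge0$. In both models, $n_t$ is almost surely finite and has finite mean and variance for every $t\ge 0$, and whenever $\mathbb{E}\,n_t\to\infty$ as $t\to\infty$, then also $\operatorname{Var} n_t\to\infty$ as $t\to\infty$ and $$\frac{n_t-\mathbb{E}\,n_t}{\sqrt{\operatorname{Var} n_t}}\xrightarrow{\ d\ }\mathcal N(0,1)\quad\text{as } t\to\infty.$$ In the BF model the condition $\mathbb{E}\,n_t\to\infty$ is always fulfilled. In the DB model it is fulfilled whenever $p_k\sim C\exp(-\alpha k^\gamma)$ as $k\to\infty$ for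 some constants $C>0$, $\alpha>0$, $\gamma\in(0,1)$. -/

import Mathlib

/-- The two models: Binary Flipping (`BF`) and Damaged Bits (`DB`). -/
inductive BitModel where
  | BF
  | DB

/-- The new state of a bit when it is selected. States are coded by `0` (idle), `1` (active) and
`2` (damaged). In `BF` the bit alternates between `0` and `1` (the value at `2` is irrelevant: that
state is never reached from `0`); in `DB` it goes `0 → 1 → 2` and then stays in `2`. -/
def BitModel.step : BitModel → ℕ → ℕ
  | .BF, x => 1 - x
  | .DB, x => min 2 (1 + x)

/-- The time of the `n`-th selection of bit `k`, when `H k i` is the time that elapses between its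
`i`-th and `(i+1)`-st selections (the `0`-th selection being the time origin). -/
noncomputable def selectionTime {Ω : Type*} (H : ℕ+ → ℕ → Ω → ℝ) (k : ℕ+) (n : ℕ) (ω : Ω) : ℝ :=
  ∑ i ∈ Finset.range n, H k i ω

/-- The number of selections of bit `k` up to and including time `t`. (For holding times that are
independent exponentials of one positive rate, the set is almost surely finite.) -/
noncomputable def numSelections {Ω : Type*} (H : ℕ+ → ℕ → Ω → ℝ) (k : ℕ+) (t : ℝ) (ω : Ω) : ℕ :=
  {n : ℕ | 1 ≤ n ∧ selectionTime H k n ω ≤ t}.ncard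

/-- The state of bit `k` at time `t`, when all bits are idle at time `0`. -/
noncomputable def bitState {Ω : Type*} (m : BitModel) (H : ℕ+ → ℕ → Ω → ℝ) (k : ℕ+) (t : ℝ)
    (ω : Ω) : ℕ :=
  m.step^[numSelections H k t ω] 0

/-- The set of the bits that are active at time `t`. -/
def activeBits {Ω : Type*} (m : BitModel) (H : ℕ+ → ℕ → Ω → ℝ) (t : ℝ) (ω : Ω) : Set ℕ+ :=
  {k : ℕ+ | bitState m H k t ω = 1}

/-- The number of the bits that are active at time `t`, as a real random variable. -/
noncomputable def numActive {Ω : Type*} (m : BitModel) (H : ℕ+ → ℕ → Ω → ℝ) (t : ℝ) (ω : Ω) : ℝ :=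
  ((activeBits m H t ω).ncard : ℝ)

/-- `H` is a family of holding times for the continuous-time model with distribution `p` on the
bits: all `H k n` are independent, and `H k n` is exponentially distributed with rate `p k`. -/
structure IsHoldingTimes {Ω : Type*} [MeasurableSpace Ω] (μ : MeasureTheory.Measure Ω)
    (p : ℕ+ → ℝ) (H : ℕ+ → ℕ → Ω → ℝ) : Prop where
  hasLaw : ∀ k n, ProbabilityTheory.HasLaw (H k n) (ProbabilityTheory.expMeasure (p k)) μ
  indep : ProbabilityTheory.iIndepFun (fun i : ℕ+ × ℕ => H i.1 i.2) μ

open MeasureTheory ProbabilityTheory Filter Topology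

/-! At a fixed time `t ≥ 0` the numbers of selections are independent, Poisson with parameter `p k *
t` for bit `k` (`measureReal_renewalCount_eq`). Hence `n_t` is almost surely a sum of independent
indicators with means `q k = m.activeProb (p k * t)`: the probability of an odd count in BF, of the
count one in DB.

Since `q k ≤ p k * t`, the means are summable. Borel–Cantelli then makes `n_t` almost surely finite,
and Fatou gives it a second moment. In both models `q k ≤ 1 / 2`, so the variance `∑ q k * (1 - q
k)` is at least half the mean and tends to infinity with it.

For the CLT, centered indicators are bounded by `1`, so the characteristic function of the centered
sum at `u` differs from `exp (-u² Var / 2)` by at most `2 |u|³ Var`. At `u = s / σ`, where `σ² =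
Var`, this error is `2 |s|³ / σ → 0`, and Lévy's continuity theorem concludes.

As for the means, in BF each `q k` tends to `1 / 2`. In DB a bit contributes substantially only
while `p k * t` has order one. When successive ratios `p (k + 1) / p k` tend to `1`, the values `p k
* t` pass through that range in ever smaller steps, so ever more bits lie in it. -/

/-! ### Characteristic functions: products and second order expansion. -/

theorem norm_prod_sub_prod_le_sum {ι : Type*} (s : Finset ι) (a b : ι → ℂ)
    (ha : ∀ i ∈ s, ‖a i‖ ≤ 1) (hb : ∀ i ∈ s, ‖b i‖ ≤ 1) :
    ‖∏ i ∈ s, a i - ∏ i ∈ s, b i‖ ≤ ∑ i ∈ s, ‖a i - b i‖ := by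
  classical
  induction s using Finset.induction_on with
  | empty => simp
  | insert i s hi ih =>
    rw [Finset.prod_insert hi, Finset.prod_insert hi, Finset.sum_insert hi]
    have h1 : ‖∏ j ∈ s, a j‖ ≤ 1 := by
      rw [norm_prod]
      exact Finset.prod_le_one (fun _ _ => norm_nonneg _)
        fun j hj => ha j (Finset.mem_insert_of_mem hj)
    have h2 := ih (fun j hj => ha j (Finset.mem_insert_of_mem hj))
      fun j hj => hb j (Finset.mem_insert_of_mem hj)
    have h3 := hb i (Finset.mem_insert_self i s)
    -- Telescoping: exchange one factor at a time, all the others having norm at most `1`.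
    calc ‖a i * ∏ j ∈ s, a j - b i * ∏ j ∈ s, b j‖
        = ‖(a i - b i) * ∏ j ∈ s, a j + b i * (∏ j ∈ s, a j - ∏ j ∈ s, b j)‖ := by ring_nf
      _ ≤ ‖a i - b i‖ * ‖∏ j ∈ s, a j‖ + ‖b i‖ * ‖∏ j ∈ s, a j - ∏ j ∈ s, b j‖ := by
          refine (norm_add_le _ _).trans ?_
          rw [norm_mul, norm_mul]
      _ ≤ ‖a i - b i‖ * 1 + 1 * ∑ j ∈ s, ‖a j - b j‖ := by gcongr
      _ = _ := by ring

/-- Second order expansion of the characteristic function of a centered variable bounded by `1`. -/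
theorem norm_charFun_sub_exp_le {Ω : Type*} [MeasurableSpace Ω] {μ : Measure Ω}
    [IsProbabilityMeasure μ] {Y : Ω → ℝ} (hY : Measurable Y) (hY1 : ∀ ω, |Y ω| ≤ 1)
    (hY0 : ∫ ω, Y ω ∂μ = 0) {u : ℝ} (hu : |u| ≤ 1) :
    ‖charFun (μ.map Y) u - Complex.exp (-(u ^ 2 * ∫ ω, Y ω ^ 2 ∂μ : ℝ) / 2)‖ ≤
      2 * |u| ^ 3 * ∫ ω, Y ω ^ 2 ∂μ := by
  set v := ∫ ω, Y ω ^ 2 ∂μ with hv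
  have hsq : ∀ ω, Y ω ^ 2 ≤ 1 := fun ω => by
    rw [← sq_abs]; exact pow_le_one₀ (abs_nonneg _) (hY1 ω)
  have hv0 : 0 ≤ v := integral_nonneg fun _ => sq_nonneg _
  have hYi : Integrable Y μ :=
    Integrable.of_bound hY.aestronglyMeasurable 1 (ae_of_all _ fun ω => hY1 ω)
  have hY2i : Integrable (fun ω => Y ω ^ 2) μ :=
    Integrable.of_bound (hY.pow_const 2).aestronglyMeasurable 1 (ae_of_all _ fun ω => by
      rw [Real.norm_of_nonneg (sq_nonneg _)]; exact hsq ω)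
  have hv1 : v ≤ 1 := by
    calc v ≤ ∫ _, (1 : ℝ) ∂μ := integral_mono hY2i (integrable_const _) hsq
      _ = 1 := by simp
  have hei : Integrable (fun ω => Complex.exp (u * Y ω * Complex.I)) μ := by
    refine Integrable.of_bound (by fun_prop) 1 (ae_of_all _ fun ω => ?_)
    rw [← Complex.ofReal_mul, Complex.norm_exp_ofReal_mul_I]
  have hc : charFun (μ.map Y) u = ∫ ω, Complex.exp (u * Y ω * Complex.I) ∂μ := by
    rw [charFun_apply_real, integral_map hY.aemeasurable (by fun_prop)]
  have hYc : ∫ ω, (u * Y ω * Complex.I : ℂ) ∂μ = 0 := by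
    rw [integral_mul_const, integral_const_mul, integral_complex_ofReal, hY0]; simp
  have hY2c : ∫ ω, ((u : ℂ) ^ 2 / 2 * ((Y ω ^ 2 : ℝ) : ℂ)) ∂μ = (u : ℂ) ^ 2 / 2 * v := by
    rw [integral_const_mul, integral_complex_ofReal]
  have e1 : charFun (μ.map Y) u - (1 - (u : ℂ) ^ 2 / 2 * v) =
      ∫ ω, (Complex.exp (u * Y ω * Complex.I) -
        (1 + u * Y ω * Complex.I - (u : ℂ) ^ 2 / 2 * ((Y ω ^ 2 : ℝ) : ℂ))) ∂μ := by
    have i1 : Integrable (fun ω => (u * Y ω * Complex.I : ℂ)) μ :=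
      (hYi.ofReal.const_mul _).mul_const _
    have i2 : Integrable (fun ω => (u : ℂ) ^ 2 / 2 * ((Y ω ^ 2 : ℝ) : ℂ)) μ :=
      hY2i.ofReal.const_mul _
    have i0 : Integrable (fun _ : Ω => (1 : ℂ)) μ := integrable_const _
    have i3 : Integrable (fun ω => (1 + u * Y ω * Complex.I : ℂ)) μ := i0.add i1
    have i4 : Integrable (fun ω => (1 + u * Y ω * Complex.I -
        (u : ℂ) ^ 2 / 2 * ((Y ω ^ 2 : ℝ) : ℂ))) μ := i3.sub i2
    rw [integral_sub hei i4, integral_sub i3 i2,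
      integral_add i0 i1, hYc, hY2c, hc]
    simp
  have b1 : ‖charFun (μ.map Y) u - (1 - (u : ℂ) ^ 2 / 2 * v)‖ ≤ |u| ^ 3 * v := by
    rw [e1, hv, ← integral_const_mul]
    refine norm_integral_le_of_norm_le (hY2i.const_mul _) (ae_of_all _ fun ω => ?_)
    have hn : ‖(u * Y ω * Complex.I : ℂ)‖ = |u| * |Y ω| := by simp
    have hle : ‖(u * Y ω * Complex.I : ℂ)‖ ≤ 1 := by
      rw [hn]; exact mul_le_one₀ hu (abs_nonneg _) (hY1 ω)
    have := Complex.exp_bound hle (n := 3) (by norm_num)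
    have e : ∑ m ∈ Finset.range 3, (u * Y ω * Complex.I : ℂ) ^ m / (m.factorial : ℂ) =
        1 + u * Y ω * Complex.I - (u : ℂ) ^ 2 / 2 * ((Y ω ^ 2 : ℝ) : ℂ) := by
      simp only [Finset.sum_range_succ, Finset.sum_range_zero, Nat.factorial]
      have := Complex.I_sq
      push_cast
      linear_combination (u : ℂ) ^ 2 * (Y ω) ^ 2 / 2 * this
    rw [e] at this
    refine this.trans ?_
    rw [hn, mul_pow]
    have h3 : |Y ω| ^ 3 ≤ Y ω ^ 2 := by
      rw [← sq_abs]; exact pow_le_pow_of_le_one (abs_nonneg _) (hY1 ω) (by norm_num)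
    calc |u| ^ 3 * |Y ω| ^ 3 * (((3 : ℕ).succ : ℝ) * (((3 : ℕ).factorial : ℝ) * (3 : ℕ) : ℝ)⁻¹)
        ≤ |u| ^ 3 * |Y ω| ^ 3 * 1 := by
          gcongr; norm_num [Nat.factorial]
      _ ≤ |u| ^ 3 * Y ω ^ 2 := by rw [mul_one]; gcongr
  -- Both errors must stay linear in `v`, so that they can be summed over the bits. Here the
  -- quadratic error `(u² v / 2)²` is weakened by `|u| ≤ 1` and `v ≤ 1`.
  have b2 : ‖Complex.exp (-(u ^ 2 * v : ℝ) / 2) - (1 - (u : ℂ) ^ 2 / 2 * v)‖ ≤ |u| ^ 3 * v := by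
    have hu2 : u ^ 2 ≤ 1 := by rw [← sq_abs]; exact pow_le_one₀ (abs_nonneg _) hu
    have huv : u ^ 2 * v ≤ 1 := mul_le_one₀ hu2 hv0 hv1
    have hz : ‖(-(u ^ 2 * v : ℝ) / 2 : ℂ)‖ = u ^ 2 * v / 2 := by
      rw [norm_div, norm_neg, Complex.norm_real, Real.norm_of_nonneg (by positivity)]; simp
    have := Complex.norm_exp_sub_one_sub_id_le (x := (-(u ^ 2 * v : ℝ) / 2 : ℂ)) (by
      rw [hz]; linarith)
    have e : Complex.exp (-(u ^ 2 * v : ℝ) / 2) - (1 - (u : ℂ) ^ 2 / 2 * v) =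
      Complex.exp (-(u ^ 2 * v : ℝ) / 2) - 1 - (-(u ^ 2 * v : ℝ) / 2 : ℂ) := by
      push_cast; ring
    rw [e]
    refine this.trans ?_
    rw [hz]
    have h4 : |u| ^ 4 ≤ |u| ^ 3 := pow_le_pow_of_le_one (abs_nonneg _) hu (by norm_num)
    have h5 : u ^ 4 = |u| ^ 4 := by rw [← abs_pow, abs_of_nonneg (by positivity)]
    have h6 : v ^ 2 ≤ v := by nlinarith
    calc (u ^ 2 * v / 2) ^ 2 = u ^ 4 * v ^ 2 / 4 := by ring
      _ ≤ |u| ^ 4 * v ^ 2 := by rw [h5]; linarith [show 0 ≤ |u| ^ 4 * v ^ 2 by positivity]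
      _ ≤ |u| ^ 3 * v := by gcongr
  calc _ = ‖(charFun (μ.map Y) u - (1 - (u : ℂ) ^ 2 / 2 * v)) -
        (Complex.exp (-(u ^ 2 * v : ℝ) / 2) - (1 - (u : ℂ) ^ 2 / 2 * v))‖ := by
          congr 1; ring
    _ ≤ _ := (norm_sub_le _ _).trans (by linarith)

/-! ### Infinite sums of independent indicators. -/

section BernoulliSeries

variable {Ω ι : Type*} [MeasurableSpace Ω] {μ : Measure Ω} [IsProbabilityMeasure μ]
  {X : ι → Ω → ℝ}

theorem variance_of_zero_or_one {Z : Ω → ℝ} (hZ : Measurable Z) (h01 : ∀ ω, Z ω = 0 ∨ Z ω = 1) :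
    variance Z μ = (∫ ω, Z ω ∂μ) * (1 - ∫ ω, Z ω ∂μ) := by
  have hb : ∀ ω, ‖Z ω‖ ≤ 1 := fun ω => by rcases h01 ω with h | h <;> simp [h]
  rw [variance_eq_sub (MemLp.of_bound hZ.aestronglyMeasurable 1 (ae_of_all _ hb))]
  have : Z ^ 2 = Z := by
    ext ω; rcases h01 ω with h | h <;> simp [h]
  rw [this]; ring

theorem variance_finsetSum_of_zero_or_one (hX : ∀ i, Measurable (X i))
    (h01 : ∀ i ω, X i ω = 0 ∨ X i ω = 1) (hind : iIndepFun X μ) (s : Finset ι) :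
    variance (fun ω => ∑ i ∈ s, X i ω) μ =
      ∑ i ∈ s, (∫ ω, X i ω ∂μ) * (1 - ∫ ω, X i ω ∂μ) := by
  have hb : ∀ i ω, ‖X i ω‖ ≤ 1 := fun i ω => by rcases h01 i ω with h | h <;> simp [h]
  have : (fun ω => ∑ i ∈ s, X i ω) = ∑ i ∈ s, X i := by ext; simp
  rw [this, IndepFun.variance_sum]
  · exact Finset.sum_congr rfl fun i _ => variance_of_zero_or_one (hX i) (h01 i)
  · exact fun i _ => MemLp.of_bound (hX i).aestronglyMeasurable 1 (ae_of_all _ (hb i))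
  · exact fun i _ j _ hij => hind.indepFun hij

variable [Countable ι] {N : Ω → ℝ}

/-- Finite partial sums have mean and variance at most `m`, the sum of all the means, hence second
moment at most `m + m ^ 2`. Fatou along the finite subsets carries this bound to `N`. -/
theorem memLp_two_of_hasSum_zero_or_one (hX : ∀ i, Measurable (X i))
    (h01 : ∀ i ω, X i ω = 0 ∨ X i ω = 1) (hind : iIndepFun X μ)
    (hs : Summable fun i => ∫ ω, X i ω ∂μ) (hN : ∀ᵐ ω ∂μ, HasSum (fun i => X i ω) (N ω)) :
    MemLp N 2 μ := by
  have hX0 : ∀ i ω, 0 ≤ X i ω := fun i ω => by rcases h01 i ω with h | h <;> simp [h]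
  have hb : ∀ i ω, ‖X i ω‖ ≤ 1 := fun i ω => by rcases h01 i ω with h | h <;> simp [h]
  have hXi : ∀ i, Integrable (X i) μ := fun i =>
    Integrable.of_bound (hX i).aestronglyMeasurable 1 (ae_of_all _ (hb i))
  have hq0 : ∀ i, 0 ≤ ∫ ω, X i ω ∂μ := fun i => integral_nonneg (hX0 i)
  have hSm : ∀ s : Finset ι, Measurable fun ω => ∑ i ∈ s, X i ω := fun s =>
    Finset.measurable_fun_sum _ fun i _ => hX i
  have hSL : ∀ s : Finset ι, MemLp (fun ω => ∑ i ∈ s, X i ω) 2 μ := fun s =>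
    memLp_finsetSum _ fun i _ =>
      MemLp.of_bound (hX i).aestronglyMeasurable 1 (ae_of_all _ (hb i))
  have hNm : AEMeasurable N μ :=
    aemeasurable_of_tendsto_metrizable_ae atTop (fun s : Finset ι => (hSm s).aemeasurable) hN
  set m := ∑' i, ∫ ω, X i ω ∂μ
  have hle : ∀ s : Finset ι, ∑ i ∈ s, ∫ ω, X i ω ∂μ ≤ m := fun s =>
    hs.sum_le_tsum s fun i _ => hq0 i
  have hm0 : 0 ≤ m := tsum_nonneg hq0
  have hS2 : ∀ s : Finset ι, ∫ ω, (∑ i ∈ s, X i ω) ^ 2 ∂μ ≤ m + m ^ 2 := by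
    intro s
    have h1 := variance_eq_sub (hSL s)
    rw [variance_finsetSum_of_zero_or_one hX h01 hind] at h1
    have h2 : ∫ ω, ∑ i ∈ s, X i ω ∂μ = ∑ i ∈ s, ∫ ω, X i ω ∂μ :=
      integral_finsetSum _ fun i _ => hXi i
    have h3 : ∑ i ∈ s, (∫ ω, X i ω ∂μ) * (1 - ∫ ω, X i ω ∂μ) ≤ ∑ i ∈ s, ∫ ω, X i ω ∂μ :=
      Finset.sum_le_sum fun i _ => by nlinarith [hq0 i]
    have h4 : (∑ i ∈ s, ∫ ω, X i ω ∂μ) ^ 2 ≤ m ^ 2 :=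
      pow_le_pow_left₀ (Finset.sum_nonneg fun i _ => hq0 i) (hle s) 2
    rw [h2] at h1
    simp only [Pi.pow_apply] at h1
    linarith [hle s]
  refine (memLp_two_iff_integrable_sq hNm.aestronglyMeasurable).2 ?_
  refine ⟨(hNm.pow_const 2).aestronglyMeasurable, ?_⟩
  have hle2 : ∫⁻ ω, ‖N ω ^ 2‖ₑ ∂μ ≤
      liminf (fun s : Finset ι => ∫⁻ ω, ‖(∑ i ∈ s, X i ω) ^ 2‖ₑ ∂μ) atTop := by
    refine le_trans (le_of_eq (lintegral_congr_ae ?_))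
      (lintegral_liminf_le fun s : Finset ι => ((hSm s).pow_const 2).enorm)
    filter_upwards [hN] with ω hω
    exact (((hω : Tendsto _ _ _).pow 2).enorm.liminf_eq).symm
  refine lt_of_le_of_lt hle2 (lt_of_le_of_lt (b := ENNReal.ofReal (m + m ^ 2)) ?_
    ENNReal.ofReal_lt_top)
  refine liminf_le_of_frequently_le' (Frequently.of_forall fun s => ?_)
  rw [← ofReal_integral_norm_eq_lintegral_enorm (hSL _).integrable_sq]
  refine ENNReal.ofReal_le_ofReal ?_
  simpa using hS2 s

/-- The partial sums lie between `0` and `N`, so `N` and `N ^ 2`, integrable by the previous lemma,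
dominate the first and second moments. -/
theorem integral_variance_of_hasSum_zero_or_one (hX : ∀ i, Measurable (X i))
    (h01 : ∀ i ω, X i ω = 0 ∨ X i ω = 1) (hind : iIndepFun X μ)
    (hs : Summable fun i => ∫ ω, X i ω ∂μ) (hN : ∀ᵐ ω ∂μ, HasSum (fun i => X i ω) (N ω)) :
    HasSum (fun i => ∫ ω, X i ω ∂μ) (∫ ω, N ω ∂μ) ∧
      HasSum (fun i => (∫ ω, X i ω ∂μ) * (1 - ∫ ω, X i ω ∂μ)) (variance N μ) := by
  have hX0 : ∀ i ω, 0 ≤ X i ω := fun i ω => by rcases h01 i ω with h | h <;> simp [h]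
  have hb : ∀ i ω, ‖X i ω‖ ≤ 1 := fun i ω => by rcases h01 i ω with h | h <;> simp [h]
  have hXi : ∀ i, Integrable (X i) μ := fun i =>
    Integrable.of_bound (hX i).aestronglyMeasurable 1 (ae_of_all _ (hb i))
  have hSm : ∀ s : Finset ι, Measurable fun ω => ∑ i ∈ s, X i ω := fun s =>
    Finset.measurable_fun_sum _ fun i _ => hX i
  have hSL : ∀ s : Finset ι, MemLp (fun ω => ∑ i ∈ s, X i ω) 2 μ := fun s =>
    memLp_finsetSum _ fun i _ =>
      MemLp.of_bound (hX i).aestronglyMeasurable 1 (ae_of_all _ (hb i))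
  have hL := memLp_two_of_hasSum_zero_or_one hX h01 hind hs hN
  have hS0 : ∀ (s : Finset ι) ω, 0 ≤ ∑ i ∈ s, X i ω := fun s ω =>
    Finset.sum_nonneg fun i _ => hX0 i ω
  have hSN : ∀ s : Finset ι, ∀ᵐ ω ∂μ, ∑ i ∈ s, X i ω ≤ N ω := fun s => by
    filter_upwards [hN] with ω hω
    exact sum_le_hasSum s (fun i _ => hX0 i ω) hω
  have hint : ∀ s : Finset ι, ∫ ω, ∑ i ∈ s, X i ω ∂μ = ∑ i ∈ s, ∫ ω, X i ω ∂μ := fun s =>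
    integral_finsetSum _ fun i _ => hXi i
  have t1 : Tendsto (fun s : Finset ι => ∫ ω, ∑ i ∈ s, X i ω ∂μ) atTop (𝓝 (∫ ω, N ω ∂μ)) := by
    refine tendsto_integral_filter_of_dominated_convergence N
      (Eventually.of_forall fun s => (hSm s).aestronglyMeasurable) (Eventually.of_forall fun s => ?_)
      (hL.integrable (by norm_num)) hN
    filter_upwards [hSN s] with ω hω
    rwa [Real.norm_of_nonneg (hS0 s ω)]
  have t2 : Tendsto (fun s : Finset ι => ∫ ω, (∑ i ∈ s, X i ω) ^ 2 ∂μ) atTop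
      (𝓝 (∫ ω, N ω ^ 2 ∂μ)) := by
    refine tendsto_integral_filter_of_dominated_convergence (fun ω => N ω ^ 2)
      (Eventually.of_forall fun s => ((hSm s).pow_const 2).aestronglyMeasurable)
      (Eventually.of_forall fun s => ?_) hL.integrable_sq ?_
    · filter_upwards [hSN s] with ω hω
      rw [Real.norm_of_nonneg (sq_nonneg _)]
      exact pow_le_pow_left₀ (hS0 s ω) hω 2
    · filter_upwards [hN] with ω hω
      exact hω.pow 2
  refine ⟨?_, ?_⟩
  · simp only [hint] at t1
    exact t1
  · have t3 := t2.sub (t1.pow 2)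
    have e : variance N μ = ∫ ω, N ω ^ 2 ∂μ - (∫ ω, N ω ∂μ) ^ 2 := variance_eq_sub hL
    rw [← e] at t3
    refine t3.congr fun s => ?_
    rw [← variance_finsetSum_of_zero_or_one hX h01 hind s, variance_eq_sub (hSL s)]
    rfl

/-- Quantitative Gaussian approximation of the characteristic function of a centered sum of
independent indicators. -/
theorem norm_charFun_centered_sub_exp_le (hX : ∀ i, Measurable (X i))
    (h01 : ∀ i ω, X i ω = 0 ∨ X i ω = 1) (hind : iIndepFun X μ)
    (hs : Summable fun i => ∫ ω, X i ω ∂μ) (hN : ∀ᵐ ω ∂μ, HasSum (fun i => X i ω) (N ω))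
    {u : ℝ} (hu : |u| ≤ 1) :
    ‖charFun (μ.map fun ω => N ω - ∫ ω', N ω' ∂μ) u -
        Complex.exp (-(u ^ 2 * variance N μ : ℝ) / 2)‖ ≤ 2 * |u| ^ 3 * variance N μ := by
  have hX0 : ∀ i ω, 0 ≤ X i ω := fun i ω => by rcases h01 i ω with h | h <;> simp [h]
  have hX1 : ∀ i ω, X i ω ≤ 1 := fun i ω => by rcases h01 i ω with h | h <;> simp [h]
  have hXi : ∀ i, Integrable (X i) μ := fun i =>
    Integrable.of_bound (hX i).aestronglyMeasurable 1 (ae_of_all _ fun ω => by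
      rw [Real.norm_of_nonneg (hX0 i ω)]; exact hX1 i ω)
  obtain ⟨hm, hv⟩ := integral_variance_of_hasSum_zero_or_one hX h01 hind hs hN
  have hL := memLp_two_of_hasSum_zero_or_one hX h01 hind hs hN
  set q : ι → ℝ := fun i => ∫ ω, X i ω ∂μ with hq
  have hq0 : ∀ i, 0 ≤ q i := fun i => integral_nonneg (hX0 i)
  have hq1 : ∀ i, q i ≤ 1 := fun i => by
    calc q i ≤ ∫ _, (1 : ℝ) ∂μ := integral_mono (hXi i) (integrable_const _) (hX1 i)
      _ = 1 := by simp
  set Y : ι → Ω → ℝ := fun i ω => X i ω - q i with hYdef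
  have hY : ∀ i, Measurable (Y i) := fun i => (hX i).sub_const _
  have hY1 : ∀ i ω, |Y i ω| ≤ 1 := fun i ω => by
    rw [abs_le]; simp only [hYdef]
    constructor <;> linarith [hX0 i ω, hX1 i ω, hq0 i, hq1 i]
  have hY0 : ∀ i, ∫ ω, Y i ω ∂μ = 0 := fun i => by
    simp only [hYdef]
    rw [integral_sub (hXi i) (integrable_const _)]
    simp [hq]
  have hY2 : ∀ i, ∫ ω, Y i ω ^ 2 ∂μ = q i * (1 - q i) := fun i => by
    rw [← variance_of_zero_or_one (hX i) (h01 i), variance_eq_integral (hX i).aemeasurable]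
  have hYind : iIndepFun Y μ :=
    hind.comp (fun i x => x - q i) fun i => measurable_id.sub_const _
  have hprod : ∀ s : Finset ι, charFun (μ.map fun ω => ∑ i ∈ s, Y i ω) u =
      ∏ i ∈ s, charFun (μ.map (Y i)) u := fun s => by
    rw [(hYind.restrict s).charFun_map_fun_finsetSum_eq_prod fun i _ => (hY i).aemeasurable]
    simp
  have hlim : Tendsto (fun s : Finset ι => charFun (μ.map fun ω => ∑ i ∈ s, Y i ω) u) atTop
      (𝓝 (charFun (μ.map fun ω => N ω - ∫ ω', N ω' ∂μ) u)) := by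
    have hNm : AEMeasurable (fun ω => N ω - ∫ ω', N ω' ∂μ) μ := hL.aemeasurable.sub_const _
    have hSm : ∀ s : Finset ι, Measurable fun ω => ∑ i ∈ s, Y i ω := fun s =>
      Finset.measurable_fun_sum _ fun i _ => hY i
    simp_rw [charFun_apply_real]
    rw [integral_map hNm (by fun_prop)]
    have : ∀ s : Finset ι, ∫ x, Complex.exp (u * x * Complex.I)
        ∂(μ.map fun ω => ∑ i ∈ s, Y i ω) =
        ∫ ω, Complex.exp (u * ((∑ i ∈ s, Y i ω : ℝ) : ℂ) * Complex.I) ∂μ := fun s =>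
      integral_map (hSm s).aemeasurable (by fun_prop)
    simp_rw [this]
    refine tendsto_integral_filter_of_dominated_convergence (fun _ => 1)
      (Eventually.of_forall fun s => ?_) (Eventually.of_forall fun s => ae_of_all _ fun ω => ?_)
      (integrable_const _) ?_
    · have := hSm s
      exact Measurable.aestronglyMeasurable (by fun_prop)
    · rw [← Complex.ofReal_mul, Complex.norm_exp_ofReal_mul_I]
    · filter_upwards [hN] with ω hω
      have h1 : Tendsto (fun s : Finset ι => ∑ i ∈ s, Y i ω) atTop
          (𝓝 (N ω - ∫ ω', N ω' ∂μ)) := hω.sub hm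
      have hcont : Continuous fun x : ℝ => Complex.exp (u * x * Complex.I) := by fun_prop
      exact (hcont.tendsto _).comp h1
  have hlim2 : Tendsto (fun s : Finset ι => ∏ i ∈ s,
      Complex.exp (-(u ^ 2 * (q i * (1 - q i)) : ℝ) / 2)) atTop
      (𝓝 (Complex.exp (-(u ^ 2 * variance N μ : ℝ) / 2))) := by
    simp_rw [← Complex.exp_sum]
    have hcont : Continuous fun x : ℝ => Complex.exp (-(u ^ 2 * x : ℝ) / 2) := by fun_prop
    refine ((hcont.tendsto _).comp hv).congr fun s => ?_
    simp only [Function.comp]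
    congr 1
    push_cast
    rw [Finset.mul_sum, ← Finset.sum_neg_distrib, Finset.sum_div]
  refine le_of_tendsto (hlim.sub hlim2).norm (Eventually.of_forall fun s => ?_)
  rw [hprod]
  refine (norm_prod_sub_prod_le_sum s _ _ (fun i _ => ?_) fun i _ => ?_).trans ?_
  · have := Measure.isProbabilityMeasure_map (μ := μ) (hY i).aemeasurable
    exact norm_charFun_le_one _
  · have h0 : 0 ≤ u ^ 2 * (q i * (1 - q i)) :=
      mul_nonneg (sq_nonneg _) (mul_nonneg (hq0 i) (by linarith [hq1 i]))
    rw [Complex.norm_exp, Real.exp_le_one_iff]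
    have : (-(u ^ 2 * (q i * (1 - q i)) : ℝ) / 2 : ℂ).re = -(u ^ 2 * (q i * (1 - q i))) / 2 := by
      rw [← Complex.ofReal_neg]
      simp only [Complex.div_ofNat_re, Complex.ofReal_re]
    rw [this]; linarith
  · calc _ ≤ ∑ i ∈ s, 2 * |u| ^ 3 * (q i * (1 - q i)) := by
          refine Finset.sum_le_sum fun i _ => ?_
          have := norm_charFun_sub_exp_le (hY i) (hY1 i) (hY0 i) hu
          rwa [hY2] at this
      _ = 2 * |u| ^ 3 * ∑ i ∈ s, q i * (1 - q i) := by rw [Finset.mul_sum]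
      _ ≤ _ := by
          gcongr
          exact sum_le_hasSum s (fun i _ => mul_nonneg (hq0 i) (by linarith [hq1 i])) hv

end BernoulliSeries

/-- A central limit theorem for families of sums of independent indicators whose variances tend to
infinity. -/
theorem tendstoInDistribution_of_hasSum_zero_or_one {Ω ι : Type*} [MeasurableSpace Ω]
    {μ : Measure Ω} [IsProbabilityMeasure μ] [Countable ι] {X : ℝ → ι → Ω → ℝ} {N : ℝ → Ω → ℝ}
    (hX : ∀ t i, Measurable (X t i)) (h01 : ∀ t i ω, X t i ω = 0 ∨ X t i ω = 1)
    (hind : ∀ t, iIndepFun (X t) μ) (hs : ∀ t, Summable fun i => ∫ ω, X t i ω ∂μ)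
    (hN : ∀ t, ∀ᵐ ω ∂μ, HasSum (fun i => X t i ω) (N t ω))
    (hV : Tendsto (fun t => variance (N t) μ) atTop atTop) :
    TendstoInDistribution
      (fun (t : ℝ) (ω : Ω) => (N t ω - ∫ ω', N t ω' ∂μ) / Real.sqrt (variance (N t) μ))
      atTop (id : ℝ → ℝ) (fun _ => μ) (gaussianReal 0 1) := by
  have hNm : ∀ t, AEMeasurable (N t) μ := fun t =>
    (memLp_two_of_hasSum_zero_or_one (hX t) (h01 t) (hind t) (hs t) (hN t)).aemeasurable
  have hm : ∀ t, AEMeasurable (fun ω => (N t ω - ∫ ω', N t ω' ∂μ) /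
      Real.sqrt (variance (N t) μ)) μ := fun t => ((hNm t).sub_const _).div_const _
  refine ⟨hm, aemeasurable_id, ?_⟩
  -- Lévy's continuity theorem is applied along an arbitrary sequence of times tending to infinity.
  refine tendsto_of_seq_tendsto fun τ hτ => ?_
  refine ProbabilityMeasure.tendsto_of_tendsto_charFun fun s => ?_
  have hVτ := hV.comp hτ
  simp only [ProbabilityMeasure.coe_mk, Measure.map_id]
  rw [charFun_gaussianReal, tendsto_iff_norm_sub_tendsto_zero]
  set σ : ℕ → ℝ := fun n => Real.sqrt (variance (N (τ n)) μ) with hσ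
  have hσt : Tendsto σ atTop atTop := Real.tendsto_sqrt_atTop.comp hVτ
  have hbd : Tendsto (fun n => 2 * |s| ^ 3 / σ n) atTop (𝓝 0) := hσt.const_div_atTop _
  refine squeeze_zero' (Eventually.of_forall fun n => norm_nonneg _) ?_ hbd
  -- `σ n ≥ |s|` brings `s / σ n` into the range `|u| ≤ 1` of the expansion, and `σ n ≥ 1` makes `σ
  -- n` positive.
  filter_upwards [hσt.eventually_ge_atTop (max 1 |s|)] with n hn
  have hσ1 : 1 ≤ σ n := (le_max_left _ _).trans hn
  have hσs : |s| ≤ σ n := (le_max_right _ _).trans hn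
  have hσ0 : 0 < σ n := by linarith
  have hu : |s / σ n| ≤ 1 := by
    rw [abs_div, abs_of_pos hσ0]; exact div_le_one_of_le₀ hσs hσ0.le
  have hsq : variance (N (τ n)) μ = σ n ^ 2 := (Real.sq_sqrt (variance_nonneg _ _)).symm
  have key := norm_charFun_centered_sub_exp_le (hX (τ n)) (h01 _) (hind _) (hs _) (hN _) hu
  have e1 : charFun (μ.map fun ω => (N (τ n) ω - ∫ ω', N (τ n) ω' ∂μ) / σ n) s =
      charFun (μ.map fun ω => N (τ n) ω - ∫ ω', N (τ n) ω' ∂μ) (s / σ n) := by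
    have := charFun_map_mul_comp (μ := μ) (((hNm (τ n)).sub_const (∫ ω', N (τ n) ω' ∂μ)))
      (σ n)⁻¹ s
    rw [div_eq_inv_mul s, ← this]
    simp only [div_eq_inv_mul]
  have e2 : (s / σ n) ^ 2 * variance (N (τ n)) μ = s ^ 2 := by
    rw [hsq]; field_simp
  have e3 : 2 * |s / σ n| ^ 3 * variance (N (τ n)) μ = 2 * |s| ^ 3 / σ n := by
    rw [hsq, abs_div, abs_of_pos hσ0]; field_simp
  rw [e2, e3, ← e1] at key
  change ‖charFun (μ.map fun ω => (N (τ n) ω - ∫ ω', N (τ n) ω' ∂μ) / σ n) s - _‖ ≤ _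
  convert key using 4
  push_cast
  simp
  ring

/-! ### Renewal counts and their measurability. -/

/-- The number of renewals up to time `t` of the renewal process with holding times `h`. -/
noncomputable def renewalCount (h : ℕ → ℝ) (t : ℝ) : ℕ :=
  {n : ℕ | 1 ≤ n ∧ ∑ i ∈ Finset.range n, h i ≤ t}.ncard

theorem strictMono_sum_range {h : ℕ → ℝ} (hpos : ∀ i, 0 < h i) :
    StrictMono fun n => ∑ i ∈ Finset.range n, h i :=
  strictMono_nat_of_lt_succ fun n => by
    rw [Finset.sum_range_succ]; linarith [hpos n]

theorem renewalCount_eq {h : ℕ → ℝ} (hpos : ∀ i, 0 < h i) {t : ℝ} {n : ℕ}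
    (h1 : ∑ i ∈ Finset.range n, h i ≤ t) (h2 : t < ∑ i ∈ Finset.range (n + 1), h i) :
    renewalCount h t = n := by
  have hm := strictMono_sum_range hpos
  have : {m : ℕ | 1 ≤ m ∧ ∑ i ∈ Finset.range m, h i ≤ t} = (Finset.Icc 1 n : Finset ℕ) := by
    ext m
    simp only [Set.mem_ofPred_eq, Finset.coe_Icc, Set.mem_Icc]
    refine and_congr_right fun _ => ⟨fun hle => ?_, fun hle => (hm.monotone hle).trans h1⟩
    exact Nat.lt_succ_iff.1 (hm.lt_iff_lt.1 (hle.trans_lt h2))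
  rw [renewalCount, this, Set.ncard_coe_finset]
  simp

theorem renewalCount_of_neg {h : ℕ → ℝ} (hpos : ∀ i, 0 < h i) {t : ℝ} (ht : t < 0) :
    renewalCount h t = 0 := by
  have : {m : ℕ | 1 ≤ m ∧ ∑ i ∈ Finset.range m, h i ≤ t} = ∅ := by
    ext m
    simp only [Set.mem_ofPred_eq, Set.mem_empty_iff_false, iff_false, not_and, not_le]
    intro _
    exact ht.trans_le (Finset.sum_nonneg fun i _ => (hpos i).le)
  rw [renewalCount, this, Set.ncard_empty]

/-- The value `0` is excluded because it is ambiguous: if all renewals occur before `t`, the set is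
infinite and its `ncard` is `0` as well. -/
theorem renewalCount_eq_iff {h : ℕ → ℝ} (hpos : ∀ i, 0 < h i) {t : ℝ} {n : ℕ} (hn : n ≠ 0) :
    renewalCount h t = n ↔
      ∑ i ∈ Finset.range n, h i ≤ t ∧ t < ∑ i ∈ Finset.range (n + 1), h i := by
  refine ⟨fun hc => ?_, fun hc => renewalCount_eq hpos hc.1 hc.2⟩
  rcases lt_or_ge t 0 with ht | ht
  · exact absurd (hc.symm.trans (renewalCount_of_neg hpos ht)) hn
  by_cases hex : ∃ m, ∑ i ∈ Finset.range m, h i ≤ t ∧ t < ∑ i ∈ Finset.range (m + 1), h i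
  · obtain ⟨m, hm⟩ := hex
    rw [← hc, renewalCount_eq hpos hm.1 hm.2]
    exact hm
  · push Not at hex
    have hall : ∀ m, ∑ i ∈ Finset.range m, h i ≤ t := fun m => by
      induction m with
      | zero => simpa using ht
      | succ m ih => exact hex m ih
    have : {m : ℕ | 1 ≤ m ∧ ∑ i ∈ Finset.range m, h i ≤ t} = Set.Ici 1 := by
      ext m; simp [hall m]
    rw [renewalCount, this, (Set.Ici_infinite 1).ncard] at hc
    exact absurd hc.symm hn

/-- Replaces the nonpositive terms of a sequence by `1`. -/
noncomputable def positivize (h : ℕ → ℝ) (i : ℕ) : ℝ := if 0 < h i then h i else 1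

theorem positivize_pos (h : ℕ → ℝ) (i : ℕ) : 0 < positivize h i := by
  unfold positivize; split_ifs with hi
  exacts [hi, one_pos]

theorem positivize_of_pos {h : ℕ → ℝ} (hpos : ∀ i, 0 < h i) : positivize h = h := by
  funext i; simp [positivize, hpos i]

@[fun_prop]
theorem measurable_positivize (i : ℕ) : Measurable fun h : ℕ → ℝ => positivize h i :=
  Measurable.ite (measurableSet_lt measurable_const (measurable_pi_apply i))
    (measurable_pi_apply i) measurable_const

theorem measurable_renewalCount_positivize (t : ℝ) :
    Measurable fun h : ℕ → ℝ => renewalCount (positivize h) t := by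
  have key : ∀ n ≠ 0, MeasurableSet ((fun h : ℕ → ℝ => renewalCount (positivize h) t) ⁻¹' {n}) := by
    intro n hn
    have : (fun h : ℕ → ℝ => renewalCount (positivize h) t) ⁻¹' {n} =
        {h | ∑ i ∈ Finset.range n, positivize h i ≤ t} ∩
          {h | t < ∑ i ∈ Finset.range (n + 1), positivize h i} := by
      ext h
      exact renewalCount_eq_iff (positivize_pos h) hn
    rw [this]
    exact (measurableSet_le (by fun_prop) (by fun_prop)).inter
      (measurableSet_lt (by fun_prop) (by fun_prop))
  refine measurable_to_countable' fun n => ?_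
  rcases eq_or_ne n 0 with rfl | hn
  · have : (fun h : ℕ → ℝ => renewalCount (positivize h) t) ⁻¹' {0} =
        (⋃ n : {n : ℕ // n ≠ 0}, (fun h : ℕ → ℝ => renewalCount (positivize h) t) ⁻¹' {n.1})ᶜ := by
      ext h
      simp only [Set.mem_preimage, Set.mem_singleton_iff, Set.mem_compl_iff, Set.mem_iUnion,
        Subtype.exists, ne_eq, exists_prop]
      simp
    rw [this]
    exact (MeasurableSet.iUnion fun n : {n : ℕ // n ≠ 0} => key n.1 n.2).compl
  · exact key n hn

/-! ### The Poisson law of the number of renewals. -/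

theorem integral_expMeasure {p : ℝ} (hp : 0 < p) (g : ℝ → ℝ) :
    ∫ y, g y ∂(expMeasure p) = ∫ y in Set.Ici 0, p * Real.exp (-(p * y)) * g y := by
  have h1 : expMeasure p = volume.withDensity (exponentialPDF p) := rfl
  rw [h1, integral_withDensity_eq_integral_toReal_smul (by unfold exponentialPDF; fun_prop)
    (ae_of_all _ fun x => by simp [exponentialPDF]), ← integral_indicator measurableSet_Ici]
  congr 1 with y
  rw [exponentialPDF_eq, smul_eq_mul, Set.indicator_apply]
  by_cases hy : 0 ≤ y
  · rw [if_pos hy, if_pos (Set.mem_Ici.2 hy), ENNReal.toReal_ofReal (by positivity)]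
  · rw [if_neg hy, if_neg (by simpa using hy)]; simp

section Poisson

variable {Ω : Type*} [MeasurableSpace Ω] {μ : Measure Ω} [IsProbabilityMeasure μ]
  {h : ℕ → Ω → ℝ} {p : ℝ}

/-- Conditioning on the last holding time, which is independent of the preceding sum. -/
theorem measureReal_sum_range_succ_le (hm : ∀ i, Measurable (h i)) (hind : iIndepFun h μ)
    (hlaw : ∀ i, μ.map (h i) = expMeasure p) (n : ℕ) (t : ℝ) :
    μ.real {ω | ∑ i ∈ Finset.range (n + 1), h i ω ≤ t} =
      ∫ y, μ.real {ω | ∑ i ∈ Finset.range n, h i ω ≤ t - y} ∂(expMeasure p) := by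
  set S : Ω → ℝ := fun ω => ∑ i ∈ Finset.range n, h i ω with hS
  have hSm : Measurable S := Finset.measurable_fun_sum _ fun i _ => hm i
  have hI : IndepFun S (h n) μ := by
    have := hind.indepFun_finsetSum_of_notMem hm (s := Finset.range n) (i := n) (by simp)
    convert this using 1
    ext; simp [hS]
  have hpm : IsProbabilityMeasure (expMeasure p) := by
    rw [← hlaw n]; exact Measure.isProbabilityMeasure_map (hm n).aemeasurable
  have hSp : IsProbabilityMeasure (μ.map S) := Measure.isProbabilityMeasure_map hSm.aemeasurable
  have hprod := (indepFun_iff_map_prod_eq_prod_map_map hSm.aemeasurable (hm n).aemeasurable).1 hI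
  rw [hlaw n] at hprod
  have hset : MeasurableSet {x : ℝ × ℝ | x.1 + x.2 ≤ t} :=
    measurableSet_le (by fun_prop) (by fun_prop)
  have e1 : μ {ω | ∑ i ∈ Finset.range (n + 1), h i ω ≤ t} =
      ((μ.map S).prod (expMeasure p)) {x : ℝ × ℝ | x.1 + x.2 ≤ t} := by
    rw [← hprod, Measure.map_apply (hSm.prodMk (hm n)) hset]
    congr 1 with ω
    simp [Finset.sum_range_succ, hS]
  rw [Measure.prod_apply_symm hset] at e1
  have e2 : ∀ y, (μ.map S) ((fun x => (x, y)) ⁻¹' {x : ℝ × ℝ | x.1 + x.2 ≤ t}) =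
      μ {ω | S ω ≤ t - y} := fun y => by
    rw [Measure.map_apply hSm (hset.preimage (by fun_prop))]
    congr 1 with ω
    simp [le_sub_iff_add_le]
  simp_rw [e2] at e1
  rw [measureReal_def, e1]
  simp_rw [measureReal_def]
  rw [integral_toReal]
  · have : Measurable fun y => (μ.map S) ((fun x => (x, y)) ⁻¹' {x : ℝ × ℝ | x.1 + x.2 ≤ t}) :=
      measurable_measure_prodMk_right hset
    simp_rw [e2] at this
    exact this.aemeasurable
  · exact ae_of_all _ fun y => measure_lt_top _ _

/-- The law of the number of renewals is Poisson, expressed by the distribution functions of the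
renewal times. -/
theorem measureReal_sum_range_le_sub (hp : 0 < p) (hm : ∀ i, Measurable (h i))
    (hind : iIndepFun h μ) (hlaw : ∀ i, μ.map (h i) = expMeasure p) (hpos : ∀ i ω, 0 < h i ω)
    (n : ℕ) (t : ℝ) :
    μ.real {ω | ∑ i ∈ Finset.range n, h i ω ≤ t} -
      μ.real {ω | ∑ i ∈ Finset.range (n + 1), h i ω ≤ t} =
      if 0 ≤ t then Real.exp (-(p * t)) * (p * t) ^ n / n.factorial else 0 := by
  have hpm : IsProbabilityMeasure (expMeasure p) := isProbabilityMeasure_expMeasure hp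
  have hneg : ∀ n (s : ℝ), s < 0 → μ.real {ω | ∑ i ∈ Finset.range n, h i ω ≤ s} = 0 := by
    intro n s hs
    have : {ω | ∑ i ∈ Finset.range n, h i ω ≤ s} = ∅ := by
      ext ω
      simp only [Set.mem_ofPred_eq, Set.mem_empty_iff_false, iff_false, not_le]
      exact hs.trans_le (Finset.sum_nonneg fun i _ => (hpos i ω).le)
    rw [this]; simp
  rcases lt_or_ge t 0 with ht | ht
  · rw [hneg _ t ht, hneg _ t ht, if_neg (not_le.2 ht), sub_zero]
  rw [if_pos ht]
  induction n generalizing t with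
  | zero =>
    have h0 : {ω | ∑ i ∈ Finset.range 0, h i ω ≤ t} = Set.univ := by ext; simp [ht]
    have h1 : μ.real {ω | ∑ i ∈ Finset.range (0 + 1), h i ω ≤ t} = 1 - Real.exp (-(p * t)) := by
      have := cdf_expMeasure_eq hp t
      rw [if_pos ht, cdf_eq_real, ← hlaw 0, map_measureReal_apply (hm 0) measurableSet_Iic] at this
      rw [← this]
      congr 1 with ω
      simp
    rw [h0, h1]; simp
  | succ n ih =>
    have hmono : ∀ n, Monotone fun s : ℝ => μ.real {ω | ∑ i ∈ Finset.range n, h i ω ≤ s} :=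
      fun n a b hab => measureReal_mono fun ω (hω : _ ≤ a) => hω.trans hab
    have hint : ∀ n, Integrable (fun y => μ.real {ω | ∑ i ∈ Finset.range n, h i ω ≤ t - y})
        (expMeasure p) := fun n =>
      Integrable.of_bound (((hmono n).measurable.comp
        (measurable_const.sub measurable_id)).aestronglyMeasurable) 1
        (ae_of_all _ fun y => by
          rw [Real.norm_of_nonneg measureReal_nonneg]; exact measureReal_le_one)
    rw [measureReal_sum_range_succ_le hm hind hlaw n, measureReal_sum_range_succ_le hm hind hlaw
      (n + 1), ← integral_sub (hint n) (hint (n + 1)), integral_expMeasure hp]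
    -- The factors `exp (-(p * y))` and `exp (-(p * (t - y)))` combine to `exp (-(p * t))`, which
    -- leaves only `(t - y) ^ n` to integrate over `[0, t]`.
    have e : ∀ y ∈ Set.Ici (0 : ℝ), p * Real.exp (-(p * y)) *
        (μ.real {ω | ∑ i ∈ Finset.range n, h i ω ≤ t - y} -
          μ.real {ω | ∑ i ∈ Finset.range (n + 1), h i ω ≤ t - y}) =
        (Set.Iic t).indicator
          (fun y => p ^ (n + 1) * Real.exp (-(p * t)) / n.factorial * (t - y) ^ n) y := by
      intro y _
      by_cases hy : y ≤ t
      · rw [ih (t - y) (sub_nonneg.2 hy), Set.indicator_of_mem (Set.mem_Iic.2 hy)]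
        have : Real.exp (-(p * t)) = Real.exp (-(p * y)) * Real.exp (-(p * (t - y))) := by
          rw [← Real.exp_add]; congr 1; ring
        rw [this, mul_pow]; ring
      · rw [Set.indicator_of_notMem (by simpa using hy), hneg _ _ (by linarith),
          hneg _ _ (by linarith)]
        simp
    rw [setIntegral_congr_fun measurableSet_Ici e, setIntegral_indicator measurableSet_Iic,
      Set.Ici_inter_Iic, integral_Icc_eq_integral_Ioc, ← intervalIntegral.integral_of_le ht,
      intervalIntegral.integral_const_mul,
      intervalIntegral.integral_comp_sub_left (fun y => y ^ n) t, integral_pow,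
      Nat.factorial_succ]
    have : (n.factorial : ℝ) ≠ 0 := by positivity
    have : (n + 1 : ℝ) ≠ 0 := by positivity
    push_cast
    rw [mul_pow]
    simp
    field_simp

/-- The events `A n` that `t` lies between the `n`-th and the next renewal are disjoint, and their
Poisson weights sum to `1`. So they exhaust the space up to a null set, and the spurious value `0`
at an explosion does not matter. -/
theorem measureReal_renewalCount_eq (hp : 0 < p) (hm : ∀ i, Measurable (h i))
    (hind : iIndepFun h μ) (hlaw : ∀ i, μ.map (h i) = expMeasure p) (hpos : ∀ i ω, 0 < h i ω)
    {t : ℝ} (ht : 0 ≤ t) (n : ℕ) :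
    μ.real {ω | renewalCount (fun i => h i ω) t = n} =
      Real.exp (-(p * t)) * (p * t) ^ n / n.factorial := by
  set A : ℕ → Set Ω := fun n => {ω | ∑ i ∈ Finset.range n, h i ω ≤ t} \
    {ω | ∑ i ∈ Finset.range (n + 1), h i ω ≤ t} with hA
  have hSm : ∀ n, MeasurableSet {ω | ∑ i ∈ Finset.range n, h i ω ≤ t} := fun n =>
    measurableSet_le (Finset.measurable_fun_sum _ fun i _ => hm i) measurable_const
  have hAm : ∀ n, MeasurableSet (A n) := fun n => (hSm n).diff (hSm _)
  have hAc : ∀ n, ∀ ω ∈ A n, renewalCount (fun i => h i ω) t = n := fun n ω hω =>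
    renewalCount_eq (fun i => hpos i ω) hω.1 (not_le.1 hω.2)
  have hAd : Pairwise (Function.onFun Disjoint A) := fun i j hij =>
    Set.disjoint_left.2 fun ω hi hj => hij ((hAc i ω hi).symm.trans (hAc j ω hj))
  have hAr : ∀ n, μ.real (A n) = Real.exp (-(p * t)) * (p * t) ^ n / n.factorial := fun n => by
    rw [hA, measureReal_sdiff _ (hSm _), measureReal_sum_range_le_sub hp hm hind hlaw hpos,
      if_pos ht]
    intro ω hω
    simp only [Set.mem_ofPred_eq, Finset.sum_range_succ] at hω ⊢
    linarith [hpos n ω]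
  have hU : μ (⋃ n, A n) = 1 := by
    rw [measure_iUnion hAd hAm]
    have hsum : HasSum (fun n => μ.real (A n)) 1 := by
      simp_rw [hAr, mul_div_assoc]
      have := (NormedSpace.expSeries_div_hasSum_exp (p * t)).mul_left (Real.exp (-(p * t)))
      rwa [← Real.exp_eq_exp_ℝ, ← Real.exp_add, neg_add_cancel, Real.exp_zero] at this
    have e : ∀ n, μ (A n) = ENNReal.ofReal (μ.real (A n)) := fun n => by simp
    simp_rw [e]
    rw [← ENNReal.ofReal_tsum_of_nonneg (fun _ => measureReal_nonneg) hsum.summable,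
      hsum.tsum_eq, ENNReal.ofReal_one]
  rw [← hAr]
  refine measureReal_congr ?_
  have hae : ∀ᵐ ω ∂μ, ω ∈ ⋃ n, A n :=
    (mem_ae_iff_prob_eq_one (MeasurableSet.iUnion hAm)).2 hU
  filter_upwards [hae] with ω hω
  obtain ⟨m, hm⟩ := Set.mem_iUnion.1 hω
  refine propext ⟨fun hc => ?_, fun hc => hAc n ω hc⟩
  have : renewalCount (fun i => h i ω) t = n := hc
  rw [← this, hAc m ω hm]
  exact hm

end Poisson

/-! ### From selection counts to independent activity indicators. -/

theorem BitModel.step_BF_iterate (n : ℕ) : BitModel.BF.step^[n] 0 = n % 2 := by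
  induction n with
  | zero => rfl
  | succ n ih => rw [Function.iterate_succ_apply', ih]; simp only [BitModel.step]; omega

theorem BitModel.step_DB_iterate (n : ℕ) : BitModel.DB.step^[n] 0 = min 2 n := by
  induction n with
  | zero => rfl
  | succ n ih => rw [Function.iterate_succ_apply', ih]; simp only [BitModel.step]; omega

/-- The probability that a bit is active, when its number of selections is Poisson with
parameter `x`. -/
noncomputable def BitModel.activeProb : BitModel → ℝ → ℝ
  | .BF, x => (1 - Real.exp (-(2 * x))) / 2
  | .DB, x => x * Real.exp (-x)

theorem measureReal_step_renewalCount {Ω : Type*} [MeasurableSpace Ω] {μ : Measure Ω}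
    [IsProbabilityMeasure μ] {h : ℕ → Ω → ℝ} {p : ℝ} (hp : 0 < p) (hm : ∀ i, Measurable (h i))
    (hind : iIndepFun h μ) (hlaw : ∀ i, μ.map (h i) = expMeasure p) (hpos : ∀ i ω, 0 < h i ω)
    {t : ℝ} (ht : 0 ≤ t) (m : BitModel) :
    μ.real {ω | m.step^[renewalCount (fun i => h i ω) t] 0 = 1} = m.activeProb (p * t) := by
  have hP := measureReal_renewalCount_eq hp hm hind hlaw hpos ht
  have hcm : Measurable fun ω => renewalCount (fun i => h i ω) t := by
    have := (measurable_renewalCount_positivize t).comp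
      (measurable_pi_lambda (fun ω i => h i ω) hm)
    convert this using 2 with ω
    simp only [Function.comp, positivize_of_pos fun i => hpos i ω]
  cases m with
  | DB =>
    have : {ω | BitModel.DB.step^[renewalCount (fun i => h i ω) t] 0 = 1} =
        {ω | renewalCount (fun i => h i ω) t = 1} := by
      ext ω
      simp only [BitModel.step_DB_iterate, Set.mem_ofPred_eq]
      omega
    rw [this, hP 1]
    simp [BitModel.activeProb, mul_comm]
  | BF =>
    have : {ω | BitModel.BF.step^[renewalCount (fun i => h i ω) t] 0 = 1} =
        ⋃ j : ℕ, {ω | renewalCount (fun i => h i ω) t = 2 * j + 1} := by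
      ext ω
      simp only [BitModel.step_BF_iterate, Set.mem_ofPred_eq, Set.mem_iUnion]
      exact Nat.odd_iff.symm
    have hd : Pairwise (Function.onFun Disjoint fun j : ℕ =>
        {ω | renewalCount (fun i => h i ω) t = 2 * j + 1}) := fun i j hij =>
      Set.disjoint_left.2 fun ω (hi : _ = _) (hj : _ = _) => hij (by omega)
    have hsum : HasSum (fun j : ℕ => μ.real {ω | renewalCount (fun i => h i ω) t = 2 * j + 1})
        (BitModel.BF.activeProb (p * t)) := by
      simp_rw [hP, mul_div_assoc]
      -- The odd Poisson weights sum to `exp (-x) * sinh x`.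
      have := (Real.hasSum_sinh (p * t)).mul_left (Real.exp (-(p * t)))
      have e : BitModel.BF.activeProb (p * t) = Real.exp (-(p * t)) * Real.sinh (p * t) := by
        rw [Real.sinh_eq, BitModel.activeProb, mul_div_assoc', mul_sub, ← Real.exp_add,
          ← Real.exp_add, neg_add_cancel, Real.exp_zero]
        congr 3; ring
      rwa [e]
    rw [this, measureReal_def, measure_iUnion hd fun j => hcm (measurableSet_singleton _)]
    have e : ∀ j : ℕ, μ {ω | renewalCount (fun i => h i ω) t = 2 * j + 1} =
      ENNReal.ofReal (μ.real {ω | renewalCount (fun i => h i ω) t = 2 * j + 1}) := fun n => by simp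
    simp_rw [e]
    rw [← ENNReal.ofReal_tsum_of_nonneg (fun _ => measureReal_nonneg) hsum.summable,
      hsum.tsum_eq, ENNReal.toReal_ofReal (hsum.nonneg fun _ => measureReal_nonneg)]

/-- Independence says that the joint law is a product measure, and a product over pairs is an
iterated product. This yields independence of whole holding time sequences across bits. -/
theorem ProbabilityTheory.iIndepFun.curry {Ω ι κ E : Type*} [MeasurableSpace Ω] {μ : Measure Ω}
    [IsProbabilityMeasure μ] [MeasurableSpace E] {X : ι → κ → Ω → E}
    (hX : ∀ i j, Measurable (X i j)) (hind : iIndepFun (fun x : ι × κ => X x.1 x.2) μ) :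
    iIndepFun (fun i ω j => X i j ω) μ := by
  have hp : ∀ i j, IsProbabilityMeasure (μ.map (X i j)) := fun i j =>
    Measure.isProbabilityMeasure_map (hX i j).aemeasurable
  have h1 := (iIndepFun_iff_map_fun_eq_infinitePi_map fun x : ι × κ => hX x.1 x.2).1 hind
  have hrow : ∀ i, μ.map (fun ω j => X i j ω) = Measure.infinitePi fun j => μ.map (X i j) :=
    fun i => (iIndepFun_iff_map_fun_eq_infinitePi_map (hX i)).1
      (hind.precomp (g := fun j => (i, j)) fun a b hab => (Prod.mk.inj hab).2)
  rw [iIndepFun_iff_map_fun_eq_infinitePi_map fun i => measurable_pi_lambda _ (hX i)]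
  simp_rw [hrow]
  rw [← Measure.infinitePi_map_curry (fun i j => μ.map (X i j)), ← h1,
    Measure.map_map (MeasurableEquiv.curry ι κ E).measurable
      (measurable_pi_lambda (fun ω (x : ι × κ) => X x.1 x.2 ω) fun x => hX x.1 x.2)]
  rfl

/-- Holding times agree almost surely with everywhere measurable and positive ones. -/
theorem IsHoldingTimes.exists_measurable_pos {Ω : Type*} [MeasurableSpace Ω] {μ : Measure Ω}
    [IsProbabilityMeasure μ] {p : ℕ+ → ℝ} (hp : ∀ k, 0 < p k) {H : ℕ+ → ℕ → Ω → ℝ}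
    (hH : IsHoldingTimes μ p H) :
    ∃ G : ℕ+ → ℕ → Ω → ℝ, (∀ k i, Measurable (G k i)) ∧ (∀ k i ω, 0 < G k i ω) ∧
      (∀ k i, μ.map (G k i) = expMeasure (p k)) ∧
      iIndepFun (fun x : ℕ+ × ℕ => G x.1 x.2) μ ∧
      ∀ᵐ ω ∂μ, ∀ k i, G k i ω = H k i ω := by
  have hm : ∀ k i, AEMeasurable (H k i) μ := fun k i => (hH.hasLaw k i).aemeasurable
  have hpos : ∀ k i, ∀ᵐ ω ∂μ, 0 < H k i ω := fun k i => by
    have hpm := isProbabilityMeasure_expMeasure (hp k)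
    have h0 : expMeasure (p k) (Set.Iic 0) = 0 := by
      have := cdf_expMeasure_eq (hp k) 0
      rw [cdf_eq_real] at this
      simpa [measureReal_def, ENNReal.toReal_eq_zero_iff] using this
    rw [← (hH.hasLaw k i).map_eq, Measure.map_apply_of_aemeasurable (hm k i) measurableSet_Iic]
      at h0
    rw [ae_iff]
    convert h0 using 2
    ext ω; simp
  set G : ℕ+ → ℕ → Ω → ℝ := fun k i ω =>
    if 0 < (hm k i).mk _ ω then (hm k i).mk _ ω else 1 with hG
  have hGH : ∀ k i, H k i =ᵐ[μ] G k i := fun k i => by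
    filter_upwards [hpos k i, (hm k i).ae_eq_mk] with ω h1 h2
    simp only [hG, ← h2, h1, if_true]
  refine ⟨G, fun k i => ?_, fun k i ω => ?_, fun k i => ?_, ?_, ?_⟩
  · exact Measurable.ite (measurableSet_lt measurable_const (hm k i).measurable_mk)
      (hm k i).measurable_mk measurable_const
  · simp only [hG]; split_ifs with h
    exacts [h, one_pos]
  · rw [← Measure.map_congr (hGH k i), (hH.hasLaw k i).map_eq]
  · exact hH.indep.congr fun x => hGH x.1 x.2
  · rw [ae_all_iff]; intro k
    rw [ae_all_iff]; intro i
    exact (hGH k i).symm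

namespace BitModel

theorem activeProb_nonneg (m : BitModel) {x : ℝ} (hx : 0 ≤ x) : 0 ≤ m.activeProb x := by
  cases m with
  | BF =>
    have : Real.exp (-(2 * x)) ≤ 1 := Real.exp_le_one_iff.2 (by linarith)
    simp only [activeProb]; linarith
  | DB => simp only [activeProb]; positivity

theorem activeProb_le_self (m : BitModel) {x : ℝ} (hx : 0 ≤ x) : m.activeProb x ≤ x := by
  cases m with
  | BF =>
    have := Real.add_one_le_exp (-(2 * x))
    simp only [activeProb]; linarith
  | DB =>
    have : Real.exp (-x) ≤ 1 := Real.exp_le_one_iff.2 (by linarith)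
    simp only [activeProb]; nlinarith

/-- This gives `1 - q ≥ 1 / 2` for each indicator, hence variance at least half the mean. For DB it
amounts to `2 * x ≤ exp x`, which follows from `exp (x / 2) ≥ 1 + x / 2` by squaring. -/
theorem activeProb_le_half (m : BitModel) (x : ℝ) : m.activeProb x ≤ 1 / 2 := by
  cases m with
  | BF =>
    have := Real.exp_pos (-(2 * x))
    simp only [activeProb]; linarith
  | DB =>
    have h1 : 2 * x ≤ Real.exp x := by
      have h2 := Real.add_one_le_exp (x / 2)
      have h3 : Real.exp x = Real.exp (x / 2) ^ 2 := by rw [← Real.exp_nat_mul]; congr 1; ring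
      rcases le_or_gt x 0 with hx | hx
      · linarith [Real.exp_pos x]
      · rw [h3]; nlinarith [sq_nonneg (x / 2 - 1)]
    simp only [activeProb]
    rw [Real.exp_neg, ← div_eq_mul_inv, div_le_iff₀ (Real.exp_pos x)]
    linarith

@[simp]
theorem activeProb_zero (m : BitModel) : m.activeProb 0 = 0 := by
  cases m <;> simp [activeProb]

theorem summable_activeProb (m : BitModel) {ι : Type*} {p : ι → ℝ} (hp : ∀ k, 0 ≤ p k)
    (hs : Summable p) {t : ℝ} (ht : 0 ≤ t) : Summable fun k => m.activeProb (p k * t) :=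
  Summable.of_nonneg_of_le (fun k => m.activeProb_nonneg (mul_nonneg (hp k) ht))
    (fun k => m.activeProb_le_self (mul_nonneg (hp k) ht)) (hs.mul_right t)

end BitModel

/-- The indicators of the active bits form, up to a null set, a family of independent random
variables with the expected means, and their sum is the number of the active bits. -/
theorem IsHoldingTimes.exists_indicators {Ω : Type*} [MeasurableSpace Ω] {μ : Measure Ω}
    [IsProbabilityMeasure μ] {p : ℕ+ → ℝ} (hp : ∀ k, 0 < p k) (hs : Summable p)
    {H : ℕ+ → ℕ → Ω → ℝ} (hH : IsHoldingTimes μ p H) (m : BitModel) :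
    ∃ X : ℝ → ℕ+ → Ω → ℝ, (∀ t k, Measurable (X t k)) ∧
      (∀ t k ω, X t k ω = 0 ∨ X t k ω = 1) ∧ (∀ t, iIndepFun (X t) μ) ∧
      (∀ t k, ∫ ω, X t k ω ∂μ = m.activeProb (p k * max t 0)) ∧
      (∀ t, ∀ᵐ ω ∂μ, (activeBits m H t ω).Finite) ∧
      ∀ t, ∀ᵐ ω ∂μ, HasSum (fun k => X t k ω) (numActive m H t ω) := by
  obtain ⟨G, hGm, hGpos, hGlaw, hGind, hGH⟩ := hH.exists_measurable_pos hp
  -- The indicator is one measurable function of a bit's holding time sequence, the same for all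
  -- bits, so independence passes from the sequences to the indicators.
  set f : ℝ → (ℕ → ℝ) → ℝ := fun t h =>
    if m.step^[renewalCount (positivize h) t] 0 = 1 then 1 else 0 with hf
  have hfm : ∀ t, Measurable (f t) := fun t =>
    (measurable_of_countable fun n : ℕ => if m.step^[n] 0 = 1 then (1 : ℝ) else 0).comp
      (measurable_renewalCount_positivize t)
  have hrow : ∀ k, Measurable fun ω i => G k i ω := fun k => measurable_pi_lambda _ (hGm k)
  have hfG : ∀ t k ω, f t (fun i => G k i ω) =
      {ω | m.step^[renewalCount (fun i => G k i ω) t] 0 = 1}.indicator 1 ω := fun t k ω => by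
    simp only [hf, positivize_of_pos fun i => hGpos k i ω, Set.indicator_apply, Pi.one_apply]
    rfl
  have hmean : ∀ t k, ∫ ω, f t (fun i => G k i ω) ∂μ = m.activeProb (p k * max t 0) := by
    intro t k
    rcases lt_or_ge t 0 with ht | ht
    · have : ∀ ω, f t (fun i => G k i ω) = 0 := fun ω => by
        simp [hf, renewalCount_of_neg (positivize_pos _) ht]
      simp [this, max_eq_right ht.le]
    · have hmeas : MeasurableSet {ω | m.step^[renewalCount (fun i => G k i ω) t] 0 = 1} := by
        have : {ω | m.step^[renewalCount (fun i => G k i ω) t] 0 = 1} =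
            (fun ω => f t (fun i => G k i ω)) ⁻¹' {1} := by
          ext ω
          simp [hf, positivize_of_pos fun i => hGpos k i ω]
        rw [this]
        exact ((hfm t).comp (hrow k)) (measurableSet_singleton _)
      simp_rw [hfG]
      rw [integral_indicator_one hmeas, max_eq_left ht]
      exact measureReal_step_renewalCount (hp k) (hGm k)
        (hGind.precomp (g := fun i => (k, i)) fun a b hab => (Prod.mk.inj hab).2)
        (hGlaw k) (hGpos k) ht m
  have hact : ∀ t, ∀ᵐ ω ∂μ, activeBits m H t ω = {k | f t (fun i => G k i ω) = 1} := fun t => by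
    filter_upwards [hGH] with ω hω
    ext k
    have e : (fun i => G k i ω) = fun i => H k i ω := funext fun i => hω k i
    have hpos : ∀ i, 0 < H k i ω := fun i => hω k i ▸ hGpos k i ω
    have e2 : f t (fun i => H k i ω) = if bitState m H k t ω = 1 then 1 else 0 := by
      simp only [hf, positivize_of_pos hpos]; rfl
    simp only [activeBits, Set.mem_ofPred_eq, e, e2]
    split_ifs with h <;> simp [h]
  have hfin : ∀ t, ∀ᵐ ω ∂μ, {k | f t (fun i => G k i ω) = 1}.Finite := fun t => by
    have hm1 : ∀ k, MeasurableSet {ω | f t (fun i => G k i ω) = 1} := fun k =>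
      ((hfm t).comp (hrow k)) (measurableSet_singleton _)
    -- Borel–Cantelli: the activity probabilities are summable.
    refine ae_finite_setOfPred_mem (s := fun k => {ω | f t (fun i => G k i ω) = 1}) ?_
    have e : ∀ k, μ {ω | f t (fun i => G k i ω) = 1} =
        ENNReal.ofReal (m.activeProb (p k * max t 0)) := fun k => by
      rw [← hmean, ← ofReal_measureReal, ← integral_indicator_one (hm1 k)]
      congr 2 with ω
      by_cases h : m.step^[renewalCount (positivize fun i => G k i ω) t] 0 = 1 <;>
        simp [hf, h]
    simp_rw [e]
    exact (m.summable_activeProb (fun k => (hp k).le) hs (le_max_right _ _)).tsum_ofReal_ne_top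
  refine ⟨fun t k ω => f t (fun i => G k i ω), fun t k => (hfm t).comp (hrow k), fun t k ω => ?_,
    fun t => (iIndepFun.curry hGm hGind).comp (fun _ => f t) fun _ => hfm t, hmean, fun t => ?_,
    fun t => ?_⟩
  · simp only [hf]; split_ifs <;> simp
  · filter_upwards [hact t, hfin t] with ω h1 h2
    rwa [h1]
  · filter_upwards [hact t, hfin t] with ω h1 h2
    rw [numActive, h1, Set.ncard_eq_toFinset_card _ h2, Finset.card_eq_sum_ones, Nat.cast_sum]
    have : ∀ k ∈ h2.toFinset, ((1 : ℕ) : ℝ) = f t fun i => G k i ω := fun k hk => by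
      have : f t (fun i => G k i ω) = 1 := by simpa using hk
      simp [this]
    rw [Finset.sum_congr rfl this]
    refine hasSum_sum_of_ne_finset_zero fun k hk => ?_
    have hk : f t (fun i => G k i ω) ≠ 1 := by simpa using hk
    by_contra h0
    refine hk ?_
    simp only [hf] at h0 ⊢
    split_ifs at h0 ⊢ with h <;> simp_all

/-! ### Divergence of the mean. -/

theorem PNat.tendsto_coe_atTop : Tendsto (fun k : ℕ+ => (k : ℕ)) atTop atTop :=
  tendsto_atTop.2 fun n => (eventually_ge_atTop n.succPNat).mono fun _ hk =>
    (Nat.le_succ n).trans (PNat.coe_le_coe _ _ |>.2 hk)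

theorem tendsto_tsum_activeProb_BF {p : ℕ+ → ℝ} (hp : ∀ k, 0 < p k) (hs : Summable p) :
    Tendsto (fun t : ℝ => ∑' k, BitModel.BF.activeProb (p k * t)) atTop atTop := by
  refine tendsto_atTop.2 fun b => ?_
  -- Among `n` bits the limiting mean is `n / 2`, which exceeds `2 * b`, hence `b` when `b > 0`.
  obtain ⟨n, hn⟩ := exists_nat_gt (4 * b)
  obtain ⟨s, hsn⟩ := Infinite.exists_subset_card_eq ℕ+ n
  have hlim : Tendsto (fun t : ℝ => ∑ k ∈ s, BitModel.BF.activeProb (p k * t)) atTop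
      (𝓝 (∑ k ∈ s, (1 - 0) / 2)) := by
    refine tendsto_finsetSum _ fun k _ => ((tendsto_const_nhds.sub ?_).div_const _)
    refine Real.tendsto_exp_neg_atTop_nhds_zero.comp ?_
    exact (tendsto_id.const_mul_atTop (hp k)).const_mul_atTop (by norm_num)
  have hgt : b < ∑ k ∈ s, ((1 : ℝ) - 0) / 2 ∨ b ≤ 0 := by
    rcases le_or_gt b 0 with h | h
    · exact Or.inr h
    · left
      rw [Finset.sum_const, hsn, nsmul_eq_mul]; linarith
  rcases hgt with hgt | hb
  · filter_upwards [hlim.eventually_const_lt hgt, eventually_ge_atTop 0] with t ht ht0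
    refine ht.le.trans ((BitModel.BF.summable_activeProb (fun k => (hp k).le) hs ht0).sum_le_tsum s
      fun k _ => BitModel.BF.activeProb_nonneg (mul_nonneg (hp k).le ht0))
  · filter_upwards [eventually_ge_atTop 0] with t ht0
    exact hb.trans (tsum_nonneg fun k =>
      BitModel.BF.activeProb_nonneg (mul_nonneg (hp k).le ht0))

/-- If successive ratios of a positive summable sequence tend to `1`, then more and more of the
numbers `p k * t` have order one as `t → ∞`. -/
theorem tendsto_tsum_activeProb_DB {p : ℕ+ → ℝ} (hp : ∀ k, 0 < p k) (hs : Summable p)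
    (hratio : Tendsto (fun k => p (k + 1) / p k) atTop (𝓝 1)) :
    Tendsto (fun t : ℝ => ∑' k, BitModel.DB.activeProb (p k * t)) atTop atTop := by
  refine tendsto_atTop.2 fun b => ?_
  -- It suffices to find `n` bits with `1 / 2 ≤ p k * t < 1`, each contributing at least `exp (-1) /
  -- 2`. The ratio bound `r` is chosen so that, by Bernoulli's inequality, `n` steps lose at most a
  -- factor `2`.
  obtain ⟨n, hn⟩ := exists_nat_gt (b / (Real.exp (-1) / 2))
  rw [div_lt_iff₀ (by positivity)] at hn
  set r : ℝ := 1 - 1 / (2 * (n + 1)) with hr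
  have hr1 : r < 1 := by
    have : (0 : ℝ) < 1 / (2 * (n + 1)) := by positivity
    linarith
  have hr0 : 0 ≤ r := by
    have : (1 : ℝ) / (2 * (n + 1)) ≤ 1 := by
      rw [div_le_one (by positivity)]; linarith [(Nat.cast_nonneg n : (0 : ℝ) ≤ n)]
    linarith
  have hrn : ∀ j ≤ n, 1 / 2 ≤ r ^ j := fun j hj => by
    have h1 := one_add_mul_le_pow (a := -(1 / (2 * (n + 1) : ℝ))) (by linarith) n
    have h2 : (n : ℝ) * (1 / (2 * (n + 1))) ≤ 1 / 2 := by
      rw [mul_one_div, div_le_div_iff₀ (by positivity) (by norm_num)]; linarith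
    have h3 : r ^ n ≤ r ^ j := pow_le_pow_of_le_one hr0 hr1.le hj
    have h4 : 1 + -(1 / (2 * (n + 1) : ℝ)) = r := by rw [hr]; ring
    rw [h4] at h1
    linarith
  obtain ⟨K, hK⟩ := eventually_atTop.1 (hratio.eventually_const_lt hr1)
  have hstep : ∀ k, K ≤ k → r * p k ≤ p (k + 1) := fun k hk =>
    ((lt_div_iff₀ (hp k)).1 (hK k hk)).le
  filter_upwards [eventually_ge_atTop (1 / p K), eventually_gt_atTop 0] with t ht ht0
  have hKt : 1 ≤ p K * t := by rwa [div_le_iff₀' (hp K)] at ht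
  have hfin : {k | 1 ≤ p k * t}.Finite := by
    have := (hs.mul_right t).tendsto_cofinite_zero.eventually_lt_const one_pos
    simpa [Filter.eventually_cofinite] using this
  -- `k₀` is the last bit with `p k * t ≥ 1`. Bits beyond it are below `1` without any monotonicity
  -- of `p`, and `t ≥ 1 / p K` forces `k₀ ≥ K`, so the ratio bound holds from `k₀` on.
  obtain ⟨k₀, hk₀, hmax⟩ := hfin.exists_maximalFor id _ ⟨K, hKt⟩
  have hKk : K ≤ k₀ := by
    by_contra h
    exact absurd (hmax hKt (not_le.1 h).le) h
  have hlt : ∀ k, k₀ < k → p k * t < 1 := fun k hk => by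
    by_contra h
    exact absurd (hmax (not_lt.1 h) hk.le) (not_le.2 hk)
  set g : ℕ → ℕ+ := fun j => ⟨k₀ + j, by positivity⟩ with hg
  have hgs : ∀ j, g (j + 1) = g j + 1 := fun j => PNat.eq (add_assoc (k₀ : ℕ) j 1).symm
  have hg0 : g 0 = k₀ := PNat.eq (by simp [hg])
  have hgle : ∀ j, k₀ ≤ g j := fun j => by
    rw [← PNat.coe_le_coe]; simp [hg]
  have hpow : ∀ j, r ^ j ≤ p (g j) * t := fun j => by
    induction j with
    | zero => rw [hg0, pow_zero]; exact hk₀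
    | succ j ih =>
      rw [hgs, pow_succ]
      have h1 := hstep (g j) (hKk.trans (hgle j))
      calc r ^ j * r ≤ p (g j) * t * r := by gcongr
        _ = r * p (g j) * t := by ring
        _ ≤ p (g j + 1) * t := by gcongr
  have hginj : Function.Injective g := fun a b hab => by
    have := congrArg PNat.val hab
    simpa [hg] using this
  -- The index `0` is left out: it is `k₀` itself, where `p k * t` has no upper bound.
  set s : Finset ℕ+ := (Finset.Icc 1 n).map ⟨g, hginj⟩ with hsdef
  have hterm : ∀ k ∈ s, Real.exp (-1) / 2 ≤ BitModel.DB.activeProb (p k * t) := fun k hk => by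
    obtain ⟨j, hj, rfl⟩ := Finset.mem_map.1 hk
    rw [Finset.mem_Icc] at hj
    have h1 : 1 / 2 ≤ p (g j) * t := (hrn j hj.2).trans (hpow j)
    have h2 : p (g j) * t < 1 := hlt _ (by
      rw [← PNat.coe_lt_coe]; simp only [hg, PNat.mk_coe]; omega)
    have h3 : Real.exp (-1) ≤ Real.exp (-(p (g j) * t)) := Real.exp_le_exp.2 (by linarith)
    calc Real.exp (-1) / 2 = 1 / 2 * Real.exp (-1) := by ring
      _ ≤ p (g j) * t * Real.exp (-(p (g j) * t)) := by gcongr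
  calc b ≤ n * (Real.exp (-1) / 2) := hn.le
    _ = ∑ k ∈ s, Real.exp (-1) / 2 := by
        rw [Finset.sum_const, hsdef, Finset.card_map, Nat.card_Icc, nsmul_eq_mul]; simp
    _ ≤ ∑ k ∈ s, BitModel.DB.activeProb (p k * t) := Finset.sum_le_sum hterm
    _ ≤ _ := (BitModel.DB.summable_activeProb (fun k => (hp k).le) hs ht0.le).sum_le_tsum s
        fun k _ => BitModel.DB.activeProb_nonneg (mul_nonneg (hp k).le ht0.le)

/-- Bernoulli's inequality for exponents in `(0, 1)` bounds the increment by `γ * x ^ (γ - 1)`. The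
condition `γ < 1` makes this vanish, so that the stretched exponential has ratios tending to `1`. -/
theorem tendsto_rpow_add_one_sub_rpow {γ : ℝ} (h0 : 0 < γ) (h1 : γ < 1) :
    Tendsto (fun x : ℝ => (x + 1) ^ γ - x ^ γ) atTop (𝓝 0) := by
  have hlim : Tendsto (fun x : ℝ => γ * x ^ (γ - 1)) atTop (𝓝 0) := by
    have := (tendsto_rpow_neg_atTop (y := 1 - γ) (by linarith)).const_mul γ
    simpa using this
  refine squeeze_zero' ?_ ?_ hlim
  · filter_upwards [eventually_gt_atTop 0] with x hx
    have := Real.rpow_le_rpow hx.le (by linarith : x ≤ x + 1) h0.le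
    linarith
  · filter_upwards [eventually_gt_atTop 0] with x hx
    have hb := rpow_one_add_le_one_add_mul_self (s := 1 / x)
      (by have : 0 < 1 / x := by positivity
          linarith) h0.le h1.le
    have e : (x + 1) ^ γ = x ^ γ * (1 + 1 / x) ^ γ := by
      rw [← Real.mul_rpow hx.le (by positivity)]; congr 1; field_simp
    have e2 : x ^ (γ - 1) = x ^ γ / x := Real.rpow_sub_one hx.ne' γ
    rw [e, e2]
    calc x ^ γ * (1 + 1 / x) ^ γ - x ^ γ ≤ x ^ γ * (1 + γ * (1 / x)) - x ^ γ := by gcongr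
      _ = γ * (x ^ γ / x) := by ring

theorem tendsto_ratio_of_isEquivalent_stretched_exp {p : ℕ+ → ℝ} {C α γ : ℝ}
    (hC : 0 < C) (h0 : 0 < γ) (h1 : γ < 1)
    (hequiv : Asymptotics.IsEquivalent atTop p
      (fun k : ℕ+ => C * Real.exp (-α * ((k : ℕ) : ℝ) ^ γ))) :
    Tendsto (fun k => p (k + 1) / p k) atTop (𝓝 1) := by
  set f : ℕ+ → ℝ := fun k => C * Real.exp (-α * ((k : ℕ) : ℝ) ^ γ) with hf
  have hsucc : Tendsto (fun k : ℕ+ => k + 1) atTop atTop :=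
    tendsto_atTop_mono (fun k => (PNat.lt_add_right k 1).le) tendsto_id
  have hq := (hequiv.comp_tendsto hsucc).div hequiv
  refine (hq.tendsto_nhds_iff (c := 1)).2 ?_
  have hk : Tendsto (fun k : ℕ+ => ((k : ℕ) : ℝ)) atTop atTop :=
    tendsto_natCast_atTop_atTop.comp PNat.tendsto_coe_atTop
  have := ((tendsto_rpow_add_one_sub_rpow h0 h1).comp hk).const_mul (-α)
  rw [mul_zero] at this
  have := (Real.continuous_exp.tendsto 0).comp this
  rw [Real.exp_zero] at this
  refine this.congr fun k => ?_
  simp only [Function.comp, hf, Pi.div_apply]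
  rw [mul_div_mul_left _ _ hC.ne', ← Real.exp_sub]
  congr 1
  push_cast
  ring

/-! ### Assembly of the theorem. -/

theorem theorem5 {Ω : Type*} [MeasurableSpace Ω] (μ : MeasureTheory.Measure Ω)
    [MeasureTheory.IsProbabilityMeasure μ]
    (p : ℕ+ → ℝ) (hp_pos : ∀ k, 0 < p k) (hp_sum : HasSum p 1)
    (H : ℕ+ → ℕ → Ω → ℝ) (hH : IsHoldingTimes μ p H) :
    (∀ m : BitModel,
      -- the number of active bits is almost surely finite and has mean and variance
      (∀ t : ℝ, 0 ≤ t → (∀ᵐ ω ∂μ, (activeBits m H t ω).Finite) ∧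
        MeasureTheory.MemLp (numActive m H t) 2 μ) ∧
      -- if the mean tends to infinity, then so does the variance, and the CLT holds
      (Filter.Tendsto (fun t : ℝ => ∫ ω, numActive m H t ω ∂μ) Filter.atTop Filter.atTop →
        Filter.Tendsto (fun t : ℝ => ProbabilityTheory.variance (numActive m H t) μ)
          Filter.atTop Filter.atTop ∧
        MeasureTheory.TendstoInDistribution
          (fun (t : ℝ) (ω : Ω) => (numActive m H t ω - ∫ ω', numActive m H t ω' ∂μ) /
            Real.sqrt (ProbabilityTheory.variance (numActive m H t) μ))
          Filter.atTop (id : ℝ → ℝ) (fun _ => μ) (ProbabilityTheory.gaussianReal 0 1))) ∧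
    -- in BF the mean always tends to infinity
    Filter.Tendsto (fun t : ℝ => ∫ ω, numActive BitModel.BF H t ω ∂μ)
      Filter.atTop Filter.atTop ∧
    -- in DB it does so when `p k ∼ C exp (-α k ^ γ)`
    (∀ C α γ : ℝ, 0 < C → 0 < α → 0 < γ → γ < 1 →
      Asymptotics.IsEquivalent Filter.atTop p
        (fun k : ℕ+ => C * Real.exp (-α * ((k : ℕ) : ℝ) ^ γ)) →
      Filter.Tendsto (fun t : ℝ => ∫ ω, numActive BitModel.DB H t ω ∂μ)
        Filter.atTop Filter.atTop) := by
  have hs := hp_sum.summable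
  have hmean : ∀ m : BitModel, (fun t : ℝ => ∑' k, m.activeProb (p k * t)) =ᶠ[atTop]
      fun t => ∫ ω, numActive m H t ω ∂μ := fun m => by
    obtain ⟨X, hXm, h01, hind, hq, hfin, hN⟩ := hH.exists_indicators hp_pos hs m
    filter_upwards [eventually_ge_atTop 0] with t ht
    have hsum : Summable fun k => ∫ ω, X t k ω ∂μ := by
      simp_rw [hq]
      exact m.summable_activeProb (fun k => (hp_pos k).le) hs (le_max_right _ _)
    have := (integral_variance_of_hasSum_zero_or_one (hXm t) (h01 t) (hind t) hsum (hN t)).1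
    simp_rw [hq, max_eq_left ht] at this
    exact this.tsum_eq
  refine ⟨fun m => ?_, (tendsto_tsum_activeProb_BF hp_pos hs).congr' (hmean _),
    fun C α γ hC _ h0 h1 hequiv => (tendsto_tsum_activeProb_DB hp_pos hs
      (tendsto_ratio_of_isEquivalent_stretched_exp hC h0 h1 hequiv)).congr' (hmean _)⟩
  obtain ⟨X, hXm, h01, hind, hq, hfin, hN⟩ := hH.exists_indicators hp_pos hs m
  have hsum : ∀ t, Summable fun k => ∫ ω, X t k ω ∂μ := fun t => by
    simp_rw [hq]
    exact m.summable_activeProb (fun k => (hp_pos k).le) hs (le_max_right _ _)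
  refine ⟨fun t _ => ⟨hfin t, memLp_two_of_hasSum_zero_or_one (hXm t) (h01 t) (hind t) (hsum t)
    (hN t)⟩, fun hinf => ?_⟩
  have hV : Tendsto (fun t => variance (numActive m H t) μ) atTop atTop := by
    refine tendsto_atTop_mono (fun t => ?_) (hinf.const_mul_atTop (by norm_num : (0 : ℝ) < 1 / 2))
    obtain ⟨h1, h2⟩ :=
      integral_variance_of_hasSum_zero_or_one (hXm t) (h01 t) (hind t) (hsum t) (hN t)
    refine hasSum_le (fun k => ?_) (h1.mul_left (1 / 2)) h2
    have hle := m.activeProb_le_half (p k * max t 0)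
    have hge := m.activeProb_nonneg (mul_nonneg (hp_pos k).le (le_max_right t 0))
    rw [hq]
    nlinarith
  exact ⟨hV, tendstoInDistribution_of_hasSum_zero_or_one hXm h01 hind hsum hN hV⟩
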